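/- **Theorem 1.4.** Let $dA(z)=\frac{dx\,dy}{\pi}$ denote the normalized area measure on $\mathbb C$ and let $\mathbb D(0,R)=\{z\in\mathbb C:|z|<R\}$. For $R>0$ and a polynomial $f$ with complex coefficients put $$\Psi_f(z,R)=\bigl(|f(z)|e^{-|z|^2}-1_{\mathbb D(0,R)}(z)\bigr)^2,\qquad z\in\mathbb C,$$ and define the planar discrepancy density and the tight planar discrepancy density by $$\rho_{\mathbb C}=\liminf_{R\to\infty}\ \inf_f\ \frac{\int_{\mathbb D(0,R)}\Psi_f(z,R)\,dA(z)}{\int_{\mathbb D(0,R)}dA(z)},\qquad \rho_{\mathbb C}^*=\liminf_{R\to\infty}\ \inf_f\ \frac{\int_{\mathbb C}\Psi_f(z,R)\,dA(z)}{\int_{\mathbb D(0,R)}dA(z)},$$ where both infima are taken over all polynomials $f$ with complex coefficients. Then $\rho_{\mathbb C}=\rho_{\mathbb C}^*$. -/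

import Mathlib

open MeasureTheory Filter
open scoped ENNReal

noncomputable section

/-- The normalized area measure `dA = dx dy / π` on the complex plane. -/
def areaMeasure : Measure ℂ := ENNReal.ofReal Real.pi⁻¹ • (volume : Measure ℂ)

/-- The planar discrepancy function
`Ψ_f(z, R) = (|f(z)| exp(-|z|²) - 1_{D(0,R)}(z))²`. -/
def planarDiscrepancy (f : ℂ → ℂ) (z : ℂ) (R : ℝ) : ℝ :=
  (‖f z‖ * Real.exp (-‖z‖ ^ 2) - (Metric.ball (0 : ℂ) R).indicator (fun _ => (1 : ℝ)) z) ^ 2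

/-- The integral of `Ψ_f(·, R)` over the disk `D(0, R)`, divided by the area of `D(0, R)`.
The integrand is nonnegative and measurable, so the value is taken in `[0, ∞]`. -/
def planarFunctional (R : ℝ) (f : Polynomial ℂ) : ℝ≥0∞ :=
  (∫⁻ z in Metric.ball (0 : ℂ) R,
      ENNReal.ofReal (planarDiscrepancy (fun w => f.eval w) z R) ∂areaMeasure) /
    areaMeasure (Metric.ball (0 : ℂ) R)

/-- The integral of `Ψ_f(·, R)` over the whole plane, divided by the area of `D(0, R)`. -/
def tightPlanarFunctional (R : ℝ) (f : Polynomial ℂ) : ℝ≥0∞ :=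
  (∫⁻ z : ℂ, ENNReal.ofReal (planarDiscrepancy (fun w => f.eval w) z R) ∂areaMeasure) /
    areaMeasure (Metric.ball (0 : ℂ) R)

/-- The planar discrepancy density `ρ_ℂ`; the infimum runs over all complex polynomials. -/
def planarDensity : ℝ≥0∞ :=
  liminf (fun R : ℝ => ⨅ f : Polynomial ℂ, planarFunctional R f) atTop

/-- The tight planar discrepancy density `ρ_ℂ*`. -/
def tightPlanarDensity : ℝ≥0∞ :=
  liminf (fun R : ℝ => ⨅ f : Polynomial ℂ, tightPlanarFunctional R f) atTop

lemma planarFunctional_le_tight (R : ℝ) (f : Polynomial ℂ) :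
    planarFunctional R f ≤ tightPlanarFunctional R f := by
  unfold planarFunctional tightPlanarFunctional
  gcongr
  exact Measure.restrict_le_self

lemma tightPlanarFunctional_zero_le_one (R : ℝ) : tightPlanarFunctional R 0 ≤ 1 := by
  have h : ∀ z : ℂ, ENNReal.ofReal
      (planarDiscrepancy (fun w => (0 : Polynomial ℂ).eval w) z R) =
      (Metric.ball (0 : ℂ) R).indicator 1 z := by
    intro z
    by_cases hz : z ∈ Metric.ball (0 : ℂ) R <;>
      simp only [planarDiscrepancy, Set.indicator_of_mem, Set.indicator_of_notMem, hz,
        not_false_eq_true] <;> simp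
  unfold tightPlanarFunctional
  simp_rw [h]
  rw [lintegral_indicator_one Metric.isOpen_ball.measurableSet]
  exact ENNReal.div_self_le_one

/-- The tight density is finite: it is at most `1`. -/
lemma tightPlanarDensity_le_one : tightPlanarDensity ≤ 1 := by
  unfold tightPlanarDensity
  calc liminf (fun R : ℝ => ⨅ f : Polynomial ℂ, tightPlanarFunctional R f) atTop
      ≤ liminf (fun _ : ℝ => (1 : ℝ≥0∞)) atTop :=
        liminf_le_liminf (Eventually.of_forall fun R =>
          (iInf_le _ 0).trans (tightPlanarFunctional_zero_le_one R))
    _ = 1 := liminf_const 1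

/-- The trivial inequality between the densities; in particular both are finite. -/
lemma planarDensity_le_tight : planarDensity ≤ tightPlanarDensity :=
  liminf_le_liminf (Eventually.of_forall fun R =>
    iInf_mono fun f => planarFunctional_le_tight R f)

end

/-!
Fix a polynomial `f` that almost minimizes the integral over the disk `|z| < R`; the task is to
destroy its mass outside the disk at a small cost. Let `F` be the truncation of `f` to degrees at
most `2 t`, with `t` slightly below `R ^ 2`. Monomials are orthogonal on every rotation invariant
set, and under `|z ^ n| ^ 2 * exp (-2 * |z| ^ 2) dA(z)` the quantity `|z| ^ 2` has the unimodal
density `s ^ n * exp (-2 * s)`, with peak at `s = n / 2`. So the mass of `F` in `|z| ^ 2 ≥ t` and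
that of `f - F` in `|z| ^ 2 < t` are carried by tails of such densities, and both are controlled,
degree by degree, by the mass of `f` in a thin annulus around `|z| ^ 2 = t`. Since the mass of `f`
in the disk is `O(R ^ 2)`, the pigeonhole principle supplies an annulus close to the boundary whose
mass is only a small multiple of `R ^ 2`. The triangle inequality in `L²` then bounds the distance
of `|F| * exp (-|z| ^ 2)` to the indicator function of the disk over the whole plane by the
corresponding distance for `f` over the disk, up to a small multiple of `R`.
-/

open scoped Topology

lemma setLIntegral_Ici_le_of_deriv_le {h h' : ℝ → ℝ} {b c : ℝ} (hc : 0 < c)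
    (hderiv : ∀ s ∈ Set.Ici b, HasDerivAt h (h' s) s) (hlim : Tendsto h atTop (𝓝 0))
    (hnonneg : ∀ s ∈ Set.Ioi b, 0 ≤ h s) (hdecay : ∀ s ∈ Set.Ioi b, h' s ≤ -(c * h s)) :
    ∫⁻ s in Set.Ici b, ENNReal.ofReal (h s) ≤ ENNReal.ofReal (h b / c) := by
  rw [← setLIntegral_congr Ioi_ae_eq_Ici]
  have hneg : ∀ s ∈ Set.Ioi b, h' s ≤ 0 := fun s hs =>
    (hdecay s hs).trans (neg_nonpos.2 (mul_nonneg hc.le (hnonneg s hs)))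
  calc ∫⁻ s in Set.Ioi b, ENNReal.ofReal (h s)
      ≤ ∫⁻ s in Set.Ioi b, ENNReal.ofReal (-h' s / c) :=
        setLIntegral_mono' measurableSet_Ioi fun s hs => ENNReal.ofReal_le_ofReal <| by
          rw [le_div_iff₀ hc]
          linarith [hdecay s hs]
    _ = ENNReal.ofReal (∫ s in Set.Ioi b, -h' s / c) := by
        refine (ofReal_integral_eq_lintegral_ofReal
          ((integrableOn_Ioi_deriv_of_nonpos' hderiv hneg hlim).neg.div_const c) ?_).symm
        filter_upwards [ae_restrict_mem measurableSet_Ioi] with s hs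
        exact div_nonneg (neg_nonneg.2 (hneg s hs)) hc.le
    _ = ENNReal.ofReal (h b / c) := by
        rw [integral_div, integral_neg, integral_Ioi_of_hasDerivAt_of_nonpos' hderiv hneg hlim]
        simp

lemma setLIntegral_Ioo_le_of_le_deriv {h h' : ℝ → ℝ} {a b c : ℝ} (hab : a ≤ b) (hc : 0 < c)
    (hcont : ContinuousOn h (Set.Icc a b)) (hderiv : ∀ s ∈ Set.Ioo a b, HasDerivAt h (h' s) s)
    (ha : 0 ≤ h a) (hnonneg : ∀ s ∈ Set.Ioo a b, 0 ≤ h s)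
    (hgrowth : ∀ s ∈ Set.Ioo a b, c * h s ≤ h' s) :
    ∫⁻ s in Set.Ioo a b, ENNReal.ofReal (h s) ≤ ENNReal.ofReal (h b / c) := by
  have hpos : ∀ s ∈ Set.Ioo a b, 0 ≤ h' s := fun s hs =>
    (mul_nonneg hc.le (hnonneg s hs)).trans (hgrowth s hs)
  have hint : IntegrableOn h' (Set.Ioc a b) :=
    intervalIntegral.integrableOn_deriv_of_nonneg hcont hderiv hpos
  calc ∫⁻ s in Set.Ioo a b, ENNReal.ofReal (h s)
      ≤ ∫⁻ s in Set.Ioo a b, ENNReal.ofReal (h' s / c) :=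
        setLIntegral_mono' measurableSet_Ioo fun s hs => ENNReal.ofReal_le_ofReal <| by
          rw [le_div_iff₀ hc]
          linarith [hgrowth s hs]
    _ = ENNReal.ofReal (∫ s in Set.Ioo a b, h' s / c) := by
        refine (ofReal_integral_eq_lintegral_ofReal
          ((hint.mono_set Set.Ioo_subset_Ioc_self).div_const c) ?_).symm
        filter_upwards [ae_restrict_mem measurableSet_Ioo] with s hs
        exact div_nonneg (hpos s hs) hc.le
    _ = ENNReal.ofReal ((h b - h a) / c) := by
        rw [integral_div, ← integral_Ioc_eq_integral_Ioo, ← intervalIntegral.integral_of_le hab,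
          intervalIntegral.integral_eq_sub_of_hasDerivAt_of_le hab hcont hderiv
            ((intervalIntegrable_iff_integrableOn_Ioc_of_le hab).2 hint)]
    _ ≤ ENNReal.ofReal (h b / c) := by
        gcongr
        linarith

/-- The density of `|z| ^ 2` under `|z ^ n| ^ 2 * exp (-2 * |z| ^ 2) dA(z)`. -/
noncomputable def gammaWeight (n : ℕ) (s : ℝ) : ℝ :=
  s ^ n * Real.exp (-(2 * s))

/-- The distribution of `|z| ^ 2` under `|z ^ n| ^ 2 * exp (-2 * |z| ^ 2) dA(z)`; it is a multiple
of a gamma distribution, left without the normalizing factor. -/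
noncomputable def gammaWeightMeasure (n : ℕ) : Measure ℝ :=
  (volume.restrict (Set.Ioi 0)).withDensity fun s => ENNReal.ofReal (gammaWeight n s)

section GammaWeight

variable {n : ℕ} {s t w : ℝ}

@[fun_prop]
lemma continuous_gammaWeight (n : ℕ) : Continuous (gammaWeight n) := by
  unfold gammaWeight
  fun_prop

lemma gammaWeight_nonneg (n : ℕ) (hs : 0 ≤ s) : 0 ≤ gammaWeight n s := by
  unfold gammaWeight
  positivity

lemma hasDerivAt_gammaWeight (n : ℕ) (hs : s ≠ 0) :
    HasDerivAt (gammaWeight n) ((n / s - 2) * gammaWeight n s) s := by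
  have hexp : HasDerivAt (fun s : ℝ => Real.exp (-(2 * s))) (Real.exp (-(2 * s)) * -(2 * 1)) s :=
    ((hasDerivAt_id s).const_mul 2).neg.exp
  refine ((hasDerivAt_pow n s).mul hexp).congr_deriv ?_
  rcases n with _ | n
  · simp only [gammaWeight, Nat.cast_zero, zero_mul, zero_div, pow_zero]
    ring
  · simp only [gammaWeight, Nat.add_sub_cancel]
    field_simp
    ring

lemma tendsto_gammaWeight_atTop (n : ℕ) : Tendsto (gammaWeight n) atTop (𝓝 0) := by
  have h := ((Real.tendsto_pow_mul_exp_neg_atTop_nhds_zero n).comp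
    (tendsto_id.const_mul_atTop (zero_lt_two (α := ℝ)))).const_mul ((2 ^ n)⁻¹ : ℝ)
  rw [mul_zero] at h
  refine h.congr fun s => ?_
  simp only [Function.comp, id, mul_pow, gammaWeight]
  field_simp

lemma antitoneOn_gammaWeight (ht : 0 < t) (hn : n ≤ 2 * t) :
    AntitoneOn (gammaWeight n) (Set.Ici t) := by
  refine antitoneOn_of_hasDerivWithinAt_nonpos (convex_Ici t)
    (continuous_gammaWeight n).continuousOn (f' := fun s => (n / s - 2) * gammaWeight n s) ?_ ?_
  · rw [interior_Ici]
    exact fun s hs => (hasDerivAt_gammaWeight n (ht.trans hs).ne').hasDerivWithinAt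
  · rw [interior_Ici]
    intro s (hs : t < s)
    have hs0 := ht.trans hs
    refine mul_nonpos_of_nonpos_of_nonneg (sub_nonpos.2 ?_) (gammaWeight_nonneg n hs0.le)
    rw [div_le_iff₀ hs0]
    linarith

lemma monotoneOn_gammaWeight (hn : 2 * t ≤ n) : MonotoneOn (gammaWeight n) (Set.Icc 0 t) := by
  refine monotoneOn_of_hasDerivWithinAt_nonneg (convex_Icc 0 t)
    (continuous_gammaWeight n).continuousOn (f' := fun s => (n / s - 2) * gammaWeight n s) ?_ ?_
  · rw [interior_Icc]
    exact fun s hs => (hasDerivAt_gammaWeight n hs.1.ne').hasDerivWithinAt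
  · rw [interior_Icc]
    intro s hs
    refine mul_nonneg (sub_nonneg.2 ?_) (gammaWeight_nonneg n hs.1.le)
    rw [le_div_iff₀ hs.1]
    linarith [hs.2]

lemma gammaWeightMeasure_apply (n : ℕ) {S : Set ℝ} (hS : MeasurableSet S)
    (hpos : S ⊆ Set.Ioi 0) :
    gammaWeightMeasure n S = ∫⁻ s in S, ENNReal.ofReal (gammaWeight n s) := by
  rw [gammaWeightMeasure, withDensity_apply _ hS, Measure.restrict_restrict hS,
    Set.inter_eq_left.2 hpos]

lemma ofReal_mul_gammaWeight_le_measure_Ico {a b m : ℝ} (ha : 0 < a)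
    (hm : ∀ s ∈ Set.Ico a b, gammaWeight n m ≤ gammaWeight n s) :
    ENNReal.ofReal (gammaWeight n m) * ENNReal.ofReal (b - a) ≤
      gammaWeightMeasure n (Set.Ico a b) := by
  rw [gammaWeightMeasure_apply n measurableSet_Ico fun s hs => ha.trans_le hs.1,
    ← Real.volume_Ico, ← setLIntegral_const]
  exact setLIntegral_mono' measurableSet_Ico fun s hs => ENNReal.ofReal_le_ofReal (hm s hs)

lemma gammaWeightMeasure_Ici_le (ht : 0 < t) (hw : 0 < w) (hn : n ≤ 2 * t) :
    gammaWeightMeasure n (Set.Ici (t + w)) ≤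
      ENNReal.ofReal (gammaWeight n (t + w) / (2 * w / (t + w))) := by
  have hpos : ∀ s ∈ Set.Ici (t + w), 0 < s := fun s (hs : t + w ≤ s) => by linarith
  rw [gammaWeightMeasure_apply n measurableSet_Ici hpos]
  refine setLIntegral_Ici_le_of_deriv_le (by positivity)
    (fun s hs => hasDerivAt_gammaWeight n (hpos s hs).ne') (tendsto_gammaWeight_atTop n)
    (fun s hs => gammaWeight_nonneg n (hpos s (Set.Ioi_subset_Ici_self hs)).le)
    fun s (hs : t + w < s) => ?_
  have hs0 := hpos s hs.le
  rw [← neg_mul]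
  refine mul_le_mul_of_nonneg_right ?_ (gammaWeight_nonneg n hs0.le)
  calc (n : ℝ) / s - 2 ≤ 2 * t / (t + w) - 2 := by gcongr
    _ = -(2 * w / (t + w)) := by
      field_simp
      ring

lemma gammaWeightMeasure_Iio_le (hw : 0 < w) (hwt : w < t) (hn : 2 * t ≤ n) :
    gammaWeightMeasure n (Set.Iio (t - w)) ≤
      ENNReal.ofReal (gammaWeight n (t - w) / (2 * w / (t + w))) := by
  have hsub : 0 < t - w := sub_pos.2 hwt
  have ht : 0 < t := hw.trans hwt
  rw [gammaWeightMeasure, withDensity_apply _ measurableSet_Iio,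
    Measure.restrict_restrict measurableSet_Iio, Set.Iio_inter_Ioi]
  refine setLIntegral_Ioo_le_of_le_deriv hsub.le (by positivity)
    (continuous_gammaWeight n).continuousOn (fun s hs => hasDerivAt_gammaWeight n hs.1.ne')
    (gammaWeight_nonneg n le_rfl) (fun s hs => gammaWeight_nonneg n hs.1.le) fun s hs => ?_
  refine mul_le_mul_of_nonneg_right ?_ (gammaWeight_nonneg n hs.1.le)
  have hs0 := hs.1
  calc 2 * w / (t + w) ≤ 2 * w / (t - w) := by gcongr; linarith
    _ = 2 * t / (t - w) - 2 := by
      field_simp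
      ring
    _ ≤ n / s - 2 := by
      have := hs.2
      gcongr

lemma ofReal_gammaWeight_div (ht : 0 < t) (hw : 0 < w) (m : ℝ) :
    ENNReal.ofReal (gammaWeight n m / (2 * w / (t + w))) =
      ENNReal.ofReal ((t + w) / (2 * w ^ 2)) *
        (ENNReal.ofReal (gammaWeight n m) * ENNReal.ofReal w) := by
  rw [← ENNReal.ofReal_mul' hw.le, ← ENNReal.ofReal_mul (by positivity)]
  congr 1
  field_simp

lemma gammaWeightMeasure_Ici_le_mul_Ico (ht : 0 < t) (hw : 0 < w) (hn : n ≤ 2 * t) :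
    gammaWeightMeasure n (Set.Ici t) ≤ ENNReal.ofReal (1 + (t + w) / (2 * w ^ 2)) *
      gammaWeightMeasure n (Set.Ico t (t + w)) := by
  have hnear : ENNReal.ofReal (gammaWeight n (t + w)) * ENNReal.ofReal w ≤
      gammaWeightMeasure n (Set.Ico t (t + w)) := by
    simpa using ofReal_mul_gammaWeight_le_measure_Ico (b := t + w) ht fun s hs =>
      antitoneOn_gammaWeight ht hn hs.1 (Set.mem_Ici.2 (by linarith)) hs.2.le
  have hfar : gammaWeightMeasure n (Set.Ici (t + w)) ≤
      ENNReal.ofReal ((t + w) / (2 * w ^ 2)) * gammaWeightMeasure n (Set.Ico t (t + w)) :=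
    (gammaWeightMeasure_Ici_le ht hw hn).trans <|
      (ofReal_gammaWeight_div ht hw _).trans_le (by gcongr)
  rw [ENNReal.ofReal_add zero_le_one (by positivity), ENNReal.ofReal_one, add_mul, one_mul,
    ← Set.Ico_union_Ici_eq_Ici (show t ≤ t + w by linarith)]
  exact (measure_union_le _ _).trans (add_le_add le_rfl hfar)

lemma gammaWeightMeasure_Iio_le_mul_Ico (hw : 0 < w) (hwt : w < t) (hn : 2 * t ≤ n) :
    gammaWeightMeasure n (Set.Iio t) ≤ ENNReal.ofReal (1 + (t + w) / (2 * w ^ 2)) *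
      gammaWeightMeasure n (Set.Ico (t - w) t) := by
  have hsub : 0 < t - w := sub_pos.2 hwt
  have ht : 0 < t := hw.trans hwt
  have hnear : ENNReal.ofReal (gammaWeight n (t - w)) * ENNReal.ofReal w ≤
      gammaWeightMeasure n (Set.Ico (t - w) t) := by
    simpa using ofReal_mul_gammaWeight_le_measure_Ico hsub fun s hs =>
      monotoneOn_gammaWeight hn ⟨hsub.le, by linarith⟩ ⟨hsub.le.trans hs.1, hs.2.le⟩ hs.1
  have hfar : gammaWeightMeasure n (Set.Iio (t - w)) ≤
      ENNReal.ofReal ((t + w) / (2 * w ^ 2)) * gammaWeightMeasure n (Set.Ico (t - w) t) :=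
    (gammaWeightMeasure_Iio_le hw hwt hn).trans <|
      (ofReal_gammaWeight_div ht hw _).trans_le (by gcongr)
  rw [ENNReal.ofReal_add zero_le_one (by positivity), ENNReal.ofReal_one, add_mul, one_mul,
    add_comm, ← Set.Iio_union_Ico_eq_Iio (show t - w ≤ t by linarith)]
  exact (measure_union_le _ _).trans (add_le_add hfar le_rfl)

end GammaWeight

lemma lintegral_Ioi_comp_sq (u : ℝ → ℝ≥0∞) :
    ∫⁻ r in Set.Ioi (0 : ℝ), ENNReal.ofReal (2 * r) * u (r ^ 2) = ∫⁻ t in Set.Ioi (0 : ℝ), u t := by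
  have himg : (fun r : ℝ => r ^ 2) '' Set.Ioi 0 = Set.Ioi 0 := by
    ext t
    constructor
    · rintro ⟨r, hr, rfl⟩
      exact pow_pos (Set.mem_Ioi.1 hr) 2
    · intro ht
      exact ⟨Real.sqrt t, Real.sqrt_pos.2 ht, Real.sq_sqrt (le_of_lt ht)⟩
  have hsubst := lintegral_image_eq_lintegral_deriv_mul_of_monotoneOn (s := Set.Ioi (0 : ℝ))
    (f := fun r => r ^ 2) (f' := fun r => 2 * r) measurableSet_Ioi
    (fun x _ => by simpa using (hasDerivAt_pow 2 x).hasDerivWithinAt)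
    (fun x hx y _ hxy => pow_le_pow_left₀ (le_of_lt hx) hxy 2) u
  rw [himg] at hsubst
  exact hsubst.symm

lemma lintegral_areaMeasure_eq_polar {g : ℂ → ℝ≥0∞} (hg : Measurable g) :
    ∫⁻ z, g z ∂areaMeasure = ∫⁻ r in Set.Ioi (0 : ℝ), ENNReal.ofReal (2 * r) *
      (ENNReal.ofReal (2 * Real.pi)⁻¹ *
        ∫⁻ θ in Set.Ioo (-Real.pi) Real.pi, g (circleMap 0 r θ)) := by
  have hpolar (p : ℝ × ℝ) : Complex.polarCoord.symm p = circleMap 0 p.1 p.2 := by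
    rw [Complex.polarCoord_symm_apply, circleMap_zero, Complex.exp_mul_I]
    push_cast
    rfl
  have hmap : Measurable fun p : ℝ × ℝ => circleMap 0 p.1 p.2 := by
    unfold circleMap
    fun_prop
  have hconst (r : ℝ) : ENNReal.ofReal Real.pi⁻¹ * ENNReal.ofReal r =
      ENNReal.ofReal (2 * r) * ENNReal.ofReal (2 * Real.pi)⁻¹ := by
    rw [← ENNReal.ofReal_mul (by positivity), ← ENNReal.ofReal_mul' (by positivity)]
    congr 1
    field_simp
  rw [areaMeasure, lintegral_smul_measure, ← Complex.lintegral_comp_polarCoord_symm,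
    polarCoord_target, Measure.volume_eq_prod, smul_eq_mul]
  simp_rw [hpolar, smul_eq_mul]
  have hjoint : Measurable fun p : ℝ × ℝ => ENNReal.ofReal p.1 * g (circleMap 0 p.1 p.2) :=
    measurable_fst.ennreal_ofReal.mul (hg.comp hmap)
  rw [setLIntegral_prod _ hjoint.aemeasurable, ← lintegral_const_mul _ hjoint.lintegral_prod_right']
  refine lintegral_congr fun r => ?_
  dsimp only
  have hcircle : Measurable fun θ => g (circleMap 0 r θ) :=
    hg.comp (continuous_circleMap 0 r).measurable
  rw [lintegral_const_mul _ hcircle, ← mul_assoc, hconst, mul_assoc]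

lemma circleAverage_eq_setIntegral_Ioo (u : ℂ → ℝ) (c : ℂ) (r : ℝ) :
    Real.circleAverage u c r =
      (2 * Real.pi)⁻¹ * ∫ θ in Set.Ioo (-Real.pi) Real.pi, u (circleMap c r θ) := by
  have hshift := ((periodic_circleMap c r).comp u).intervalIntegral_add_eq 0 (-Real.pi)
  rw [zero_add, show -Real.pi + 2 * Real.pi = Real.pi by ring] at hshift
  rw [Real.circleAverage, smul_eq_mul, ← integral_Ioc_eq_integral_Ioo,
    ← intervalIntegral.integral_of_le (by linarith [Real.pi_pos])]
  exact congrArg _ hshift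

lemma lintegral_enorm_sq_eval_circleMap (f : Polynomial ℂ) (r : ℝ) :
    ENNReal.ofReal (2 * Real.pi)⁻¹ *
        ∫⁻ θ in Set.Ioo (-Real.pi) Real.pi, ‖f.eval (circleMap 0 r θ)‖ₑ ^ 2 =
      ∑' n, ‖f.coeff n‖ₑ ^ 2 * ENNReal.ofReal ((r ^ 2) ^ n) := by
  set g := f.comp (Polynomial.C (r : ℂ) * Polynomial.X) with hg
  have heval (θ : ℝ) : g.eval (circleMap 0 1 θ) = f.eval (circleMap 0 r θ) := by
    simp [hg, circleMap_zero]
  have hcoeff (n : ℕ) : ‖g.coeff n‖ₑ ^ 2 = ‖f.coeff n‖ₑ ^ 2 * ENNReal.ofReal ((r ^ 2) ^ n) := by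
    rw [hg, Polynomial.comp_C_mul_X_coeff, enorm_mul, mul_pow, enorm_pow, ← ofReal_norm (r : ℂ),
      Complex.norm_real, Real.norm_eq_abs, ← ENNReal.ofReal_pow (abs_nonneg r),
      ← ENNReal.ofReal_pow (by positivity), ← pow_mul, mul_comm n 2, pow_mul, sq_abs]
  have hcont : Continuous fun θ : ℝ => ‖g.eval (circleMap 0 1 θ)‖ ^ 2 :=
    (g.continuous.comp (continuous_circleMap 0 1)).norm.pow 2
  have hparseval := g.sum_sq_norm_coeff_eq_circleAverage
  rw [circleAverage_eq_setIntegral_Ioo] at hparseval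
  have henorm (z : ℂ) : ‖z‖ₑ ^ 2 = ENNReal.ofReal (‖z‖ ^ 2) := by
    rw [ENNReal.ofReal_pow (norm_nonneg z), ofReal_norm]
  simp_rw [← hcoeff, ← heval, henorm]
  rw [← ofReal_integral_eq_lintegral_ofReal
      (hcont.integrableOn_Icc.mono_set Set.Ioo_subset_Icc_self)
      (Eventually.of_forall fun θ => by positivity),
    ← ENNReal.ofReal_mul (by positivity), ← hparseval,
    ENNReal.ofReal_sum_of_nonneg fun n _ => by positivity]
  refine (tsum_eq_sum fun n hn => ?_).symm
  simp [Polynomial.notMem_support_iff.1 hn]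

lemma lintegral_enorm_sq_eval_mul_radial (f : Polynomial ℂ) {ρ : ℝ → ℝ≥0∞} (hρ : Measurable ρ) :
    ∫⁻ z, ‖f.eval z‖ₑ ^ 2 * ρ (‖z‖ ^ 2) ∂areaMeasure =
      ∑' n, ‖f.coeff n‖ₑ ^ 2 * ∫⁻ t in Set.Ioi 0, ENNReal.ofReal (t ^ n) * ρ t := by
  have hf : Measurable fun z : ℂ => ‖f.eval z‖ₑ ^ 2 := f.continuous.measurable.enorm.pow_const 2
  have hcircle (r : ℝ) : ENNReal.ofReal (2 * Real.pi)⁻¹ *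
      ∫⁻ θ in Set.Ioo (-Real.pi) Real.pi,
        ‖f.eval (circleMap 0 r θ)‖ₑ ^ 2 * ρ (‖circleMap 0 r θ‖ ^ 2) =
      ∑' n, ‖f.coeff n‖ₑ ^ 2 * (ENNReal.ofReal ((r ^ 2) ^ n) * ρ (r ^ 2)) := by
    have hfr : Measurable fun θ => ‖f.eval (circleMap 0 r θ)‖ₑ ^ 2 :=
      hf.comp (continuous_circleMap 0 r).measurable
    simp_rw [norm_circleMap_zero, sq_abs, ← mul_assoc]
    rw [ENNReal.tsum_mul_right, ← lintegral_enorm_sq_eval_circleMap,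
      lintegral_mul_const _ hfr, mul_assoc]
  rw [lintegral_areaMeasure_eq_polar (g := fun z => ‖f.eval z‖ₑ ^ 2 * ρ (‖z‖ ^ 2)) (by fun_prop)]
  simp_rw [hcircle]
  rw [lintegral_Ioi_comp_sq fun t => ∑' n, ‖f.coeff n‖ₑ ^ 2 * (ENNReal.ofReal (t ^ n) * ρ t),
    lintegral_tsum fun n => by fun_prop]
  refine tsum_congr fun n => lintegral_const_mul _ (by fun_prop)

/-- The rotation invariant set of the points `z` with `|z| ^ 2 ∈ S`. -/
def radialSet (S : Set ℝ) : Set ℂ :=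
  {z | ‖z‖ ^ 2 ∈ S}

lemma measurableSet_radialSet {S : Set ℝ} (hS : MeasurableSet S) : MeasurableSet (radialSet S) :=
  (by fun_prop : Measurable fun z : ℂ => ‖z‖ ^ 2) hS

lemma areaMeasure_radialSet {S : Set ℝ} (hS : MeasurableSet S) :
    areaMeasure (radialSet S) = volume (S ∩ Set.Ioi 0) := by
  have h := lintegral_enorm_sq_eval_mul_radial 1 (measurable_one.indicator hS)
  rw [tsum_eq_single 0 fun n hn => by simp [Polynomial.coeff_one, hn]] at h
  have hind (z : ℂ) : S.indicator (1 : ℝ → ℝ≥0∞) (‖z‖ ^ 2) = (radialSet S).indicator 1 z := rfl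
  simpa [hind, lintegral_indicator_one, measurableSet_radialSet hS, hS] using h

/-- The Fock space modulus `|f(z)| * exp (-|z| ^ 2)` of a polynomial; the discrepancies measure its
distance to the indicator function of a disk. -/
noncomputable def fockModulus (f : Polynomial ℂ) (z : ℂ) : ℝ :=
  ‖f.eval z‖ * Real.exp (-‖z‖ ^ 2)

/-- The distribution of `|z| ^ 2` under the mass `fockModulus f z ^ 2 dA(z)`. -/
noncomputable def fockRadialMeasure (f : Polynomial ℂ) : Measure ℝ :=
  (areaMeasure.withDensity fun z => ‖fockModulus f z‖ₑ ^ 2).map fun z => ‖z‖ ^ 2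

lemma continuous_fockModulus (f : Polynomial ℂ) : Continuous (fockModulus f) :=
  f.continuous.norm.mul (by fun_prop)

lemma abs_fockModulus_sub_le (f g : Polynomial ℂ) (z : ℂ) :
    |fockModulus f z - fockModulus g z| ≤ |fockModulus (g - f) z| := by
  simp only [fockModulus, ← sub_mul, abs_mul, Polynomial.eval_sub, abs_norm,
    norm_sub_rev (g.eval z)]
  gcongr
  exact abs_norm_sub_norm_le _ _

lemma fockRadialMeasure_apply (f : Polynomial ℂ) {S : Set ℝ} (hS : MeasurableSet S) :
    fockRadialMeasure f S = ∫⁻ z in radialSet S, ‖fockModulus f z‖ₑ ^ 2 ∂areaMeasure := by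
  rw [fockRadialMeasure, Measure.map_apply (by fun_prop) hS]
  exact withDensity_apply _ (measurableSet_radialSet hS)

lemma fockRadialMeasure_eq_tsum (f : Polynomial ℂ) {S : Set ℝ} (hS : MeasurableSet S) :
    fockRadialMeasure f S = ∑' n, ‖f.coeff n‖ₑ ^ 2 * gammaWeightMeasure n S := by
  have hρ : Measurable (S.indicator fun t => ENNReal.ofReal (Real.exp (-(2 * t)))) :=
    Measurable.indicator (by fun_prop) hS
  have hmodulus (z : ℂ) : ‖fockModulus f z‖ₑ ^ 2 =
      ‖f.eval z‖ₑ ^ 2 * ENNReal.ofReal (Real.exp (-(2 * ‖z‖ ^ 2))) := by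
    rw [fockModulus, enorm_mul, enorm_norm, mul_pow, Real.enorm_of_nonneg (Real.exp_pos _).le,
      ← ENNReal.ofReal_pow (Real.exp_pos _).le, ← Real.exp_nat_mul]
    congr 3
    push_cast
    ring
  have hgamma (n : ℕ) : gammaWeightMeasure n S = ∫⁻ t in Set.Ioi 0, ENNReal.ofReal (t ^ n) *
      S.indicator (fun t => ENNReal.ofReal (Real.exp (-(2 * t)))) t := by
    rw [gammaWeightMeasure, withDensity_apply _ hS, ← lintegral_indicator hS]
    refine setLIntegral_congr_fun measurableSet_Ioi fun t (ht : 0 < t) => ?_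
    by_cases htS : t ∈ S
    · simp only [gammaWeight, htS, Set.indicator_of_mem, ENNReal.ofReal_mul (pow_nonneg ht.le n)]
    · simp only [htS, not_false_eq_true, Set.indicator_of_notMem, mul_zero]
  simp_rw [hgamma]
  rw [← lintegral_enorm_sq_eval_mul_radial f hρ, fockRadialMeasure_apply f hS,
    ← lintegral_indicator (measurableSet_radialSet hS)]
  refine lintegral_congr fun z => ?_
  by_cases hz : ‖z‖ ^ 2 ∈ S
  · rw [Set.indicator_of_mem hz, Set.indicator_of_mem (s := radialSet S) hz, hmodulus]
  · rw [Set.indicator_of_notMem hz, Set.indicator_of_notMem (s := radialSet S) hz, mul_zero]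

lemma exists_fockRadialMeasure_Iio_add_Ici_le (f : Polynomial ℂ) {t w : ℝ} (hw : 0 < w)
    (hwt : w < t) : ∃ F : Polynomial ℂ,
      fockRadialMeasure (f - F) (Set.Iio t) + fockRadialMeasure F (Set.Ici t) ≤
        ENNReal.ofReal (1 + (t + w) / (2 * w ^ 2)) *
          fockRadialMeasure f (Set.Ico (t - w) (t + w)) := by
  have ht : 0 < t := hw.trans hwt
  refine ⟨PowerSeries.trunc (⌊2 * t⌋₊ + 1) (f : PowerSeries ℂ), ?_⟩
  rw [fockRadialMeasure_eq_tsum _ measurableSet_Iio, fockRadialMeasure_eq_tsum _ measurableSet_Ici,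
    fockRadialMeasure_eq_tsum _ measurableSet_Ico, ← ENNReal.tsum_add, ← ENNReal.tsum_mul_left]
  refine ENNReal.tsum_le_tsum fun n => ?_
  rw [Polynomial.coeff_sub, PowerSeries.coeff_trunc, Polynomial.coeff_coe, mul_left_comm]
  split_ifs with hn
  · have hn' : (n : ℝ) ≤ 2 * t := (Nat.le_floor_iff (by positivity)).1 (Nat.lt_succ_iff.1 hn)
    rw [sub_self, enorm_zero, zero_pow two_ne_zero, zero_mul, zero_add]
    refine mul_le_mul_right ((gammaWeightMeasure_Ici_le_mul_Ico ht hw hn').trans ?_) _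
    gcongr
    linarith
  · have hn' : 2 * t ≤ n := (Nat.lt_of_floor_lt (by lia)).le
    rw [sub_zero, enorm_zero, zero_pow two_ne_zero, zero_mul, add_zero]
    refine mul_le_mul_right ((gammaWeightMeasure_Iio_le_mul_Ico hw hwt hn').trans ?_) _
    gcongr
    linarith

lemma exists_measure_Ico_le_div (ν : Measure ℝ) (b : ℝ) {w : ℝ} (hw : 0 ≤ w) {N : ℕ}
    (hN : N ≠ 0) : ∃ t : ℝ, b - 2 * N * w ≤ t - w ∧ t + w ≤ b ∧
      ν (Set.Ico (t - w) (t + w)) ≤ ν (Set.Iio b) / N := by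
  let u : ℕ → ℝ := fun j => b - 2 * j * w
  have hu : Antitone u := fun i j hij => by
    simp only [u]
    gcongr
  have hdisj : Set.PairwiseDisjoint (↑(Finset.range N)) fun j => Set.Ico (u (j + 1)) (u j) :=
    fun i _ j _ hij => hu.pairwise_disjoint_on_Ico_succ hij
  have hsub : (⋃ j ∈ Finset.range N, Set.Ico (u (j + 1)) (u j)) ⊆ Set.Iio b :=
    Set.iUnion₂_subset fun j _ x hx => hx.2.trans_le ((hu j.zero_le).trans_eq (by simp [u]))
  have hsum : ∑ j ∈ Finset.range N, ν (Set.Ico (u (j + 1)) (u j)) ≤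
      ∑ _j ∈ Finset.range N, ν (Set.Iio b) / N := by
    rw [← measure_biUnion_finset hdisj fun j _ => measurableSet_Ico, Finset.sum_const,
      Finset.card_range, nsmul_eq_mul, ENNReal.mul_div_cancel (by exact_mod_cast hN) (by simp)]
    exact measure_mono hsub
  obtain ⟨j, hj, hle⟩ := ENNReal.exists_le_of_sum_le (Finset.nonempty_range_iff.2 hN) hsum
  have hbot : b - (2 * j + 1) * w - w = u (j + 1) := by
    simp only [u]
    push_cast
    ring
  have htop : b - (2 * j + 1) * w + w = u j := by
    simp only [u]
    ring
  refine ⟨b - (2 * j + 1) * w, ?_, ?_, ?_⟩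
  · exact hbot ▸ hu (Finset.mem_range.1 hj)
  · exact htop.trans_le ((hu j.zero_le).trans_eq (by simp [u]))
  · rwa [hbot, htop]

lemma eLpNorm_two_sq {α ε : Type*} [MeasurableSpace α] [ENorm ε] (g : α → ε) (μ : Measure α) :
    eLpNorm g 2 μ ^ 2 = ∫⁻ x, ‖g x‖ₑ ^ 2 ∂μ := by
  simpa using eLpNorm_nnreal_pow_eq_lintegral (f := g) (μ := μ) (p := 2) two_ne_zero

lemma eLpNorm_indicator_one_sq {α : Type*} [MeasurableSpace α] (μ : Measure α) {S : Set α}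
    (hS : MeasurableSet S) : eLpNorm (S.indicator (1 : α → ℝ)) 2 μ ^ 2 = μ S := by
  rw [eLpNorm_indicator_eq_eLpNorm_restrict hS, eLpNorm_two_sq]
  simp

lemma eLpNorm_fockModulus_restrict_sq (f : Polynomial ℂ) {S : Set ℝ} (hS : MeasurableSet S) :
    eLpNorm (fockModulus f) 2 (areaMeasure.restrict (radialSet S)) ^ 2 = fockRadialMeasure f S := by
  rw [eLpNorm_two_sq, fockRadialMeasure_apply f hS]

lemma ball_eq_radialSet {R : ℝ} (hR : 0 ≤ R) :
    Metric.ball (0 : ℂ) R = radialSet (Set.Iio (R ^ 2)) := by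
  ext z
  simp [radialSet, sq_lt_sq₀ (norm_nonneg z) hR]

lemma areaMeasure_ball {R : ℝ} (hR : 0 ≤ R) :
    areaMeasure (Metric.ball (0 : ℂ) R) = ENNReal.ofReal (R ^ 2) := by
  rw [ball_eq_radialSet hR, areaMeasure_radialSet measurableSet_Iio, Set.Iio_inter_Ioi,
    Real.volume_Ioo, sub_zero]

/-- The signed discrepancy between `|f(z)| * exp (-|z| ^ 2)` and the indicator function of the disk
of radius `R`, whose square is `Ψ_f(z, R)`. -/
noncomputable def diskDefect (f : Polynomial ℂ) (R : ℝ) (z : ℂ) : ℝ :=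
  fockModulus f z - (Metric.ball (0 : ℂ) R).indicator 1 z

lemma measurable_diskDefect (f : Polynomial ℂ) (R : ℝ) : Measurable (diskDefect f R) :=
  (continuous_fockModulus f).measurable.sub (measurable_one.indicator measurableSet_ball)

lemma ofReal_planarDiscrepancy (f : Polynomial ℂ) (z : ℂ) (R : ℝ) :
    ENNReal.ofReal (planarDiscrepancy (fun w => f.eval w) z R) = ‖diskDefect f R z‖ₑ ^ 2 := by
  rw [← enorm_pow, Real.enorm_of_nonneg (sq_nonneg _)]
  rfl

lemma planarFunctional_eq (f : Polynomial ℂ) {R : ℝ} (hR : 0 ≤ R) :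
    planarFunctional R f =
      eLpNorm (diskDefect f R) 2 (areaMeasure.restrict (Metric.ball 0 R)) ^ 2 /
        ENNReal.ofReal (R ^ 2) := by
  simp_rw [planarFunctional, ofReal_planarDiscrepancy, areaMeasure_ball hR, eLpNorm_two_sq]

lemma tightPlanarFunctional_eq (f : Polynomial ℂ) {R : ℝ} (hR : 0 ≤ R) :
    tightPlanarFunctional R f =
      eLpNorm (diskDefect f R) 2 areaMeasure ^ 2 / ENNReal.ofReal (R ^ 2) := by
  simp_rw [tightPlanarFunctional, ofReal_planarDiscrepancy, areaMeasure_ball hR, eLpNorm_two_sq]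

lemma eLpNorm_fockModulus_sub_indicator_sq_le (f F : Polynomial ℂ) (t : ℝ) :
    eLpNorm (fockModulus F - (radialSet (Set.Iio t)).indicator (fockModulus f)) 2 areaMeasure ^ 2 ≤
      fockRadialMeasure (f - F) (Set.Iio t) + fockRadialMeasure F (Set.Ici t) := by
  have hE : MeasurableSet (radialSet (Set.Iio t)) := measurableSet_radialSet measurableSet_Iio
  have hcompl : (radialSet (Set.Iio t))ᶜ = radialSet (Set.Ici t) := by
    ext z
    simp [radialSet]
  rw [fockRadialMeasure_apply _ measurableSet_Iio, fockRadialMeasure_apply _ measurableSet_Ici,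
    eLpNorm_two_sq, ← lintegral_add_compl _ hE, ← hcompl]
  refine add_le_add (setLIntegral_mono' hE fun z hz => ?_)
    (setLIntegral_mono' hE.compl fun z hz => ?_)
  · rw [Pi.sub_apply, Set.indicator_of_mem hz]
    gcongr 1
    exact enorm_le_iff_norm_le.2 (abs_fockModulus_sub_le F f z)
  · rw [Pi.sub_apply, Set.indicator_of_notMem hz, sub_zero]

lemma eLpNorm_diskDefect_le (f F : Polynomial ℂ) {R t : ℝ} (hR : 0 ≤ R) (htR : t ≤ R ^ 2) :
    eLpNorm (diskDefect F R) 2 areaMeasure ≤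
      eLpNorm (diskDefect f R) 2 (areaMeasure.restrict (Metric.ball 0 R)) +
        eLpNorm (fockModulus F - (radialSet (Set.Iio t)).indicator (fockModulus f)) 2 areaMeasure +
        eLpNorm ((radialSet (Set.Ico t (R ^ 2))).indicator (1 : ℂ → ℝ)) 2 areaMeasure := by
  set E := radialSet (Set.Iio t)
  set A := radialSet (Set.Ico t (R ^ 2))
  have hE : MeasurableSet E := measurableSet_radialSet measurableSet_Iio
  have hA : MeasurableSet A := measurableSet_radialSet measurableSet_Ico
  have hEball : E ⊆ Metric.ball 0 R := by
    rw [ball_eq_radialSet hR]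
    exact fun z hz => lt_of_lt_of_le hz htR
  have hsplit : diskDefect F R = E.indicator (diskDefect f R) +
      (fockModulus F - E.indicator (fockModulus f)) - A.indicator 1 := by
    ext z
    simp only [diskDefect, ball_eq_radialSet hR, E, A, radialSet, Set.indicator, Set.mem_ofPred_eq,
      Set.mem_Iio, Set.mem_Ico, Pi.add_apply, Pi.sub_apply, Pi.one_apply]
    grind
  have hdefect := (measurable_diskDefect f R).indicator hE
  have htrunc := (continuous_fockModulus F).measurable.sub
    ((continuous_fockModulus f).measurable.indicator hE)
  rw [hsplit]
  refine (eLpNorm_sub_le (hdefect.add htrunc).aestronglyMeasurable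
    (measurable_one.indicator hA).aestronglyMeasurable one_le_two).trans ?_
  gcongr
  refine (eLpNorm_add_le hdefect.aestronglyMeasurable htrunc.aestronglyMeasurable
    one_le_two).trans ?_
  gcongr
  rw [eLpNorm_indicator_eq_eLpNorm_restrict hE]
  exact eLpNorm_mono_measure _ (Measure.restrict_mono_set _ hEball)

lemma eLpNorm_fockModulus_ball_le (f : Polynomial ℂ) {R : ℝ} (hR : 0 ≤ R) :
    eLpNorm (fockModulus f) 2 (areaMeasure.restrict (Metric.ball 0 R)) ≤
      eLpNorm (diskDefect f R) 2 (areaMeasure.restrict (Metric.ball 0 R)) + ENNReal.ofReal R := by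
  have hone : eLpNorm ((Metric.ball (0 : ℂ) R).indicator (1 : ℂ → ℝ)) 2
      (areaMeasure.restrict (Metric.ball 0 R)) = ENNReal.ofReal R := by
    rw [← (ENNReal.pow_right_strictMono two_ne_zero).injective.eq_iff,
      eLpNorm_indicator_one_sq _ measurableSet_ball, Measure.restrict_apply_self,
      areaMeasure_ball hR, ENNReal.ofReal_pow hR]
  have hsplit : fockModulus f = diskDefect f R + (Metric.ball (0 : ℂ) R).indicator 1 := by
    ext z
    simp [diskDefect]
  rw [← hone]
  nth_rewrite 1 [hsplit]
  exact eLpNorm_add_le (measurable_diskDefect f R).aestronglyMeasurable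
    (measurable_one.indicator measurableSet_ball).aestronglyMeasurable one_le_two

lemma fockRadialMeasure_Iio_sq_le {f : Polynomial ℂ} {R : ℝ} (hR : 0 ≤ R)
    (hf : eLpNorm (diskDefect f R) 2 (areaMeasure.restrict (Metric.ball 0 R)) ≤
      ENNReal.ofReal R) :
    fockRadialMeasure f (Set.Iio (R ^ 2)) ≤ ENNReal.ofReal ((2 * R) ^ 2) := by
  rw [← eLpNorm_fockModulus_restrict_sq f measurableSet_Iio, ← ball_eq_radialSet hR,
    ENNReal.ofReal_pow (by positivity), two_mul, ENNReal.ofReal_add hR hR]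
  gcongr
  exact (eLpNorm_fockModulus_ball_le f hR).trans (add_le_add_left hf _)

lemma exists_fockRadialMeasure_Iio_add_Ici_le_sq {k : ℕ} (hk : 2 ≤ k) {R : ℝ} (hR : 0 < R)
    (hkR : 2 * (k : ℝ) ^ 8 ≤ R ^ 2) {f : Polynomial ℂ}
    (hf : eLpNorm (diskDefect f R) 2 (areaMeasure.restrict (Metric.ball 0 R)) ≤
      ENNReal.ofReal R) :
    ∃ (F : Polynomial ℂ) (t : ℝ), R ^ 2 - (R / k) ^ 2 ≤ t ∧ t ≤ R ^ 2 ∧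
      fockRadialMeasure (f - F) (Set.Iio t) + fockRadialMeasure F (Set.Ici t) ≤
        ENNReal.ofReal ((3 * R / k) ^ 2) := by
  have hk2 : (2 : ℝ) ≤ k := by exact_mod_cast hk
  -- `k ^ 2` annuli of half-width `w` fill exactly the range `(R ^ 2 - (R / k) ^ 2, R ^ 2)` of
  -- `|z| ^ 2`, while `t + w ≤ 2 * w ^ 2` keeps the constant of the truncation at most `2`.
  set w := R ^ 2 / (2 * (k : ℝ) ^ 4) with hw
  have hw0 : 0 < w := by positivity
  obtain ⟨t, hbot, htop, hmass⟩ := exists_measure_Ico_le_div (fockRadialMeasure f) (R ^ 2) hw0.le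
    (N := k ^ 2) (by positivity)
  replace hbot : R ^ 2 - (R / k) ^ 2 ≤ t - w := by
    convert hbot using 2
    push_cast
    rw [hw]
    field_simp
  have hwt : w < t := by
    have : (R / k) ^ 2 < R ^ 2 := by
      gcongr
      exact div_lt_self hR (by linarith)
    linarith
  have hconst : 1 + (t + w) / (2 * w ^ 2) ≤ 2 := by
    have : 2 * w ^ 2 = R ^ 2 * (R ^ 2 / (2 * (k : ℝ) ^ 8)) := by
      rw [hw]
      field_simp
    have : t + w ≤ 2 * w ^ 2 := this ▸ htop.trans
      (le_mul_of_one_le_right (sq_nonneg R) ((one_le_div (by positivity)).2 hkR))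
    linarith [(div_le_one (show 0 < 2 * w ^ 2 by positivity)).2 this]
  obtain ⟨F, hF⟩ := exists_fockRadialMeasure_Iio_add_Ici_le f hw0 hwt
  refine ⟨F, t, by linarith, by linarith, hF.trans ?_⟩
  calc _ ≤ ENNReal.ofReal 2 * (ENNReal.ofReal ((2 * R) ^ 2) / (k ^ 2 : ℕ)) := by
        gcongr
        exact hmass.trans (ENNReal.div_le_div_right (fockRadialMeasure_Iio_sq_le hR.le hf) _)
    _ = ENNReal.ofReal (2 * ((2 * R) ^ 2 / k ^ 2)) := by
        rw [← ENNReal.ofReal_natCast, ← ENNReal.ofReal_div_of_pos (by positivity),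
          ← ENNReal.ofReal_mul zero_le_two, Nat.cast_pow]
    _ ≤ ENNReal.ofReal ((3 * R / k) ^ 2) := by
        gcongr
        rw [div_pow, ← mul_div_assoc]
        gcongr
        linarith [sq_nonneg R]

lemma exists_eLpNorm_diskDefect_le_add {k : ℕ} (hk : 2 ≤ k) {R : ℝ} (hR : 0 < R)
    (hkR : 2 * (k : ℝ) ^ 8 ≤ R ^ 2) {f : Polynomial ℂ}
    (hf : eLpNorm (diskDefect f R) 2 (areaMeasure.restrict (Metric.ball 0 R)) ≤
      ENNReal.ofReal R) :
    ∃ F : Polynomial ℂ, eLpNorm (diskDefect F R) 2 areaMeasure ≤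
      eLpNorm (diskDefect f R) 2 (areaMeasure.restrict (Metric.ball 0 R)) +
        ENNReal.ofReal (4 * R / k) := by
  obtain ⟨F, t, htR, hRt, hmass⟩ := exists_fockRadialMeasure_Iio_add_Ici_le_sq hk hR hkR hf
  have htrunc : eLpNorm (fockModulus F - (radialSet (Set.Iio t)).indicator (fockModulus f)) 2
      areaMeasure ≤ ENNReal.ofReal (3 * R / k) := by
    rw [← ENNReal.pow_le_pow_left_iff two_ne_zero, ← ENNReal.ofReal_pow (by positivity)]
    exact (eLpNorm_fockModulus_sub_indicator_sq_le f F t).trans hmass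
  have hannulus : eLpNorm ((radialSet (Set.Ico t (R ^ 2))).indicator (1 : ℂ → ℝ)) 2 areaMeasure ≤
      ENNReal.ofReal (R / k) := by
    rw [← ENNReal.pow_le_pow_left_iff two_ne_zero, ← ENNReal.ofReal_pow (by positivity),
      eLpNorm_indicator_one_sq _ (measurableSet_radialSet measurableSet_Ico),
      areaMeasure_radialSet measurableSet_Ico]
    calc volume (Set.Ico t (R ^ 2) ∩ Set.Ioi 0) ≤ volume (Set.Ico t (R ^ 2)) :=
          measure_mono Set.inter_subset_left
      _ = ENNReal.ofReal (R ^ 2 - t) := Real.volume_Ico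
      _ ≤ ENNReal.ofReal ((R / k) ^ 2) := ENNReal.ofReal_le_ofReal (by linarith)
  refine ⟨F, (eLpNorm_diskDefect_le f F hR.le hRt).trans ?_⟩
  rw [show 4 * R / k = 3 * R / k + R / k by ring,
    ENNReal.ofReal_add (by positivity) (by positivity), ← add_assoc]
  gcongr

lemma exists_tightPlanarFunctional_le {k : ℕ} (hk : 2 ≤ k) {R : ℝ} (hR : 0 < R)
    (hkR : 2 * (k : ℝ) ^ 8 ≤ R ^ 2) {f : Polynomial ℂ} (hf : planarFunctional R f ≤ 1) :
    ∃ F : Polynomial ℂ,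
      tightPlanarFunctional R F ≤ planarFunctional R f + ENNReal.ofReal (16 / k) := by
  have hB0 : ENNReal.ofReal (R ^ 2) ≠ 0 := (ENNReal.ofReal_pos.2 (by positivity)).ne'
  rw [planarFunctional_eq f hR.le] at hf ⊢
  set a := eLpNorm (diskDefect f R) 2 (areaMeasure.restrict (Metric.ball 0 R))
  have ha : a ≤ ENNReal.ofReal R := by
    rwa [ENNReal.div_le_iff hB0 ENNReal.ofReal_ne_top, one_mul, ENNReal.ofReal_pow hR.le,
      ENNReal.pow_le_pow_left_iff two_ne_zero] at hf
  obtain ⟨F, hF⟩ := exists_eLpNorm_diskDefect_le_add hk hR hkR ha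
  refine ⟨F, ?_⟩
  rw [tightPlanarFunctional_eq F hR.le, ENNReal.div_le_iff hB0 ENNReal.ofReal_ne_top, add_mul,
    ENNReal.div_mul_cancel hB0 ENNReal.ofReal_ne_top]
  calc eLpNorm (diskDefect F R) 2 areaMeasure ^ 2
      ≤ (a + ENNReal.ofReal (4 * R / k)) ^ 2 := by gcongr
    _ = a ^ 2 + (2 * a * ENNReal.ofReal (4 * R / k) + ENNReal.ofReal (4 * R / k) ^ 2) := by ring
    _ ≤ a ^ 2 + (2 * ENNReal.ofReal R * ENNReal.ofReal (4 * R / k) +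
          ENNReal.ofReal (4 * R / k) ^ 2) := by gcongr
    _ = a ^ 2 + ENNReal.ofReal (2 * R * (4 * R / k) + (4 * R / k) ^ 2) := by
        rw [ENNReal.ofReal_add (by positivity) (by positivity), ENNReal.ofReal_mul (by positivity),
          ENNReal.ofReal_mul zero_le_two, ENNReal.ofReal_pow (by positivity), ENNReal.ofReal_ofNat]
    _ ≤ a ^ 2 + ENNReal.ofReal (16 / k) * ENNReal.ofReal (R ^ 2) := by
        rw [← ENNReal.ofReal_mul (by positivity)]
        gcongr
        have hk2 : (2 : ℝ) ≤ k := by exact_mod_cast hk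
        field_simp
        linarith

lemma eventually_iInf_tightPlanarFunctional_le {k : ℕ} (hk : 2 ≤ k) :
    ∀ᶠ R : ℝ in atTop, ⨅ f : Polynomial ℂ, tightPlanarFunctional R f ≤
      (⨅ f : Polynomial ℂ, planarFunctional R f) + ENNReal.ofReal (16 / k) := by
  filter_upwards [eventually_gt_atTop 0,
    (tendsto_pow_atTop two_ne_zero).eventually_ge_atTop (2 * (k : ℝ) ^ 8)] with R hR hkR
  rw [ENNReal.iInf_add]
  refine le_iInf fun f => ?_
  rcases le_total (planarFunctional R f) 1 with hf | hf
  · obtain ⟨F, hF⟩ := exists_tightPlanarFunctional_le hk hR hkR hf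
    exact (iInf_le _ F).trans hF
  · exact (iInf_le _ 0).trans ((tightPlanarFunctional_zero_le_one R).trans
      (hf.trans le_self_add))

lemma tightPlanarDensity_le_add {k : ℕ} (hk : 2 ≤ k) :
    tightPlanarDensity ≤ planarDensity + ENNReal.ofReal (16 / k) := by
  have hadd : liminf (fun R : ℝ => (⨅ f : Polynomial ℂ, planarFunctional R f) +
      ENNReal.ofReal (16 / k)) atTop = planarDensity + ENNReal.ofReal (16 / k) :=
    (Monotone.map_liminf_of_continuousAt (F := (atTop : Filter ℝ))
      (f := fun x : ℝ≥0∞ => x + ENNReal.ofReal (16 / k)) (fun _ _ hxy => add_le_add_left hxy _)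
      _ (by fun_prop)).symm
  exact (liminf_le_liminf (eventually_iInf_tightPlanarFunctional_le hk)).trans_eq hadd

/-- The planar discrepancy density and the tight planar discrepancy density coincide. -/
theorem theorem1p4 : planarDensity = tightPlanarDensity := by
  refine le_antisymm planarDensity_le_tight ?_
  have hlim : Tendsto (fun k : ℕ => planarDensity + ENNReal.ofReal (16 / k)) atTop
      (𝓝 (planarDensity + ENNReal.ofReal 0)) :=
    (ENNReal.tendsto_ofReal (tendsto_const_div_atTop_nhds_zero_nat 16)).const_add _
  rw [ENNReal.ofReal_zero, add_zero] at hlim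
  exact ge_of_tendsto hlim ((eventually_ge_atTop 2).mono fun k hk => tightPlanarDensity_le_add hk)
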